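/- Let $P$, $\mathcal L$ and $\mathcal H$ be the sets of points, lines and hyperplanes of real projective 3-space $\mathrm{PG}(3,\mathbb R)$, i.e. the sets of 1-, 2- and 3-dimensional linear subspaces of $\mathbb R^4$, with the usual Grassmann manifold topologies. A topological parallelism $\Pi$ is an equivalence relation ("parallel") on $\mathcal L$ such that for every $(p,L)\in P\times\mathcal L$ there is a unique line $\Pi(p,L)$ that passes through $p$ and is parallel to $L$, and such that the map $(p,L)\mapsto \Pi(p,L)$, $P\times\mathcal L\to\mathcal L$, is continuous. Let $\mathrm{Aut}\,\Pi$ be the group of all collineations of $\mathrm{PG}(3,\mathbb R)$ preserving this equivalence relation, and let it act on the set $\mathcal L/\Pi$ of parallel classes in the natural way. For a point $p$ and a hyperplane $H$ let $\mathcal L_p$ be the set of lines through $p$ and $\mathcal L_H$ the set of lines contained in $H$, with the subspace topologies from $\mathcal L$. Lemma. Let $\Pi$ be a topological parallelism on $\mathrm{PG}(3,\mathbb R)$. There is a unique topology on $\mathcal L/\Pi$ such that for every subgroup $\Psi\le\mathrm{Aut}\,\Pi$ the following hold. 1. For every point $p$ fixed by $\Psi$, the map $\alpha_p:\mathcal L_p\to\mathcal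 L/\Pi$ sending a line to its parallel class is a $\Psi$-equivariant homeomorphism; that is, the actions of $\Psi$ on $\mathcal L_p$ and on $\mathcal L/\Pi$ are topologically equivalent via $\alpha_p$. 2. For every hyperplane $H$ fixed by $\Psi$, the map $\beta_H:\mathcal L_H\to\mathcal L/\Pi$ sending a line to its parallel class is a $\Psi$-equivariant homeomorphism; that is, the actions of $\Psi$ on $\mathcal L_H$ and on $\mathcal L/\Pi$ are topologically equivalent via $\beta_H$. (Taking $\Psi$ trivial, $\alpha_p$ and $\beta_H$ are homeomorphisms for all points $p$ and all hyperplanes $H$; in particular the topology depends neither on $\Psi$ nor on the choice of $p$ or $H$.) -/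

import Mathlib

namespace PG3

/-- The real vector space `ℝ⁴` underlying real projective 3-space. -/
abbrev V : Type := EuclideanSpace ℝ (Fin 4)

/-- The set of `k`-dimensional linear subspaces of `ℝ⁴`. -/
def Gr (k : ℕ) : Type := {W : Submodule ℝ V // Module.finrank ℝ W = k}

/-- The subspace spanned by a linearly independent `k`-tuple. -/
def Gr.ofFrame {k : ℕ} (v : {v : Fin k → V // LinearIndependent ℝ v}) : Gr k :=
  ⟨Submodule.span ℝ (Set.range v.1), by simpa using finrank_span_eq_card v.2⟩

/-- The usual topology of the Grassmann manifold: the quotient topology from the (open) set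
of linearly independent `k`-tuples of vectors. -/
instance (k : ℕ) : TopologicalSpace (Gr k) :=
  TopologicalSpace.coinduced Gr.ofFrame inferInstance

/-- Points of the projective space. -/
abbrev Pt : Type := Gr 1

/-- Lines of the projective space. -/
abbrev Ln : Type := Gr 2

/-- Hyperplanes (planes) of the projective space. -/
abbrev Hyp : Type := Gr 3

/-- Incidence of a point, line or hyperplane with another one, that is, containment. -/
def Inc {j k : ℕ} (A : Gr j) (B : Gr k) : Prop := A.1 ≤ B.1

/-- A subspace is contained in another one if and only if all its points are. -/
theorem inc_iff_points {j k : ℕ} (A : Gr j) (B : Gr k) :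
    Inc A B ↔ ∀ p : Pt, Inc p A → Inc p B := by
  constructor
  · intro h p hp
    exact le_trans hp h
  · intro h x hx
    by_cases h0 : x = 0
    · rw [h0]; exact B.1.zero_mem
    · have hp := h ⟨Submodule.span ℝ {x}, finrank_span_singleton h0⟩
        (show Submodule.span ℝ {x} ≤ A.1 from (Submodule.span_singleton_le_iff_mem x A.1).2 hx)
      exact (Submodule.span_singleton_le_iff_mem x B.1).1 hp

/-- The group of collineations: pairs of a bijection of the points and a bijection of the lines
which together preserve incidence in both directions. -/
def collineationGroup : Subgroup (Equiv.Perm Pt × Equiv.Perm Ln) where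
  carrier := {g | ∀ (p : Pt) (l : Ln), Inc (g.1 p) (g.2 l) ↔ Inc p l}
  mul_mem' := by
    intro a b ha hb p l
    exact (ha (b.1 p) (b.2 l)).trans (hb p l)
  one_mem' := fun _ _ => Iff.rfl
  inv_mem' := by
    intro a ha p l
    have h := ha (a.1⁻¹ p) (a.2⁻¹ l)
    simpa using h.symm

abbrev Collineation : Type := collineationGroup

instance : MulAction Collineation Pt where
  smul g p := g.1.1 p
  one_smul _ := rfl
  mul_smul _ _ _ := rfl

instance : MulAction Collineation Ln where
  smul g l := g.1.2 l
  one_smul _ := rfl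
  mul_smul _ _ _ := rfl

theorem inc_smul_iff (g : Collineation) (p : Pt) (l : Ln) : Inc (g • p) (g • l) ↔ Inc p l :=
  g.2 p l

/-- A parallelism: an equivalence relation on the set of lines such that for every point `p` and
every line `l` there is a unique line through `p` parallel to `l`. -/
structure Parallelism where
  rel : Setoid Ln
  existsUnique_parallel : ∀ (p : Pt) (l : Ln), ∃! m : Ln, Inc p m ∧ rel m l

namespace Parallelism

variable (Par : Parallelism)

/-- The unique line through `p` parallel to `l`. -/
noncomputable def parallel (p : Pt) (l : Ln) : Ln := (Par.existsUnique_parallel p l).choose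

/-- A parallelism is topological if the line through `p` parallel to `l` depends continuously on
the pair `(p, l)`. -/
def IsTopological : Prop := Continuous fun x : Pt × Ln => Par.parallel x.1 x.2

/-- The automorphism group: the collineations that preserve the relation of parallelity. -/
def aut : Subgroup Collineation where
  carrier := {g | ∀ l m : Ln, Par.rel (g • l) (g • m) ↔ Par.rel l m}
  mul_mem' := by
    intro a b ha hb l m
    rw [mul_smul, mul_smul]
    exact (ha _ _).trans (hb l m)
  one_mem' := fun _ _ => Iff.rfl
  inv_mem' := by
    intro a ha l m
    have h := ha (a⁻¹ • l) (a⁻¹ • m)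
    simpa using h.symm

/-- The set of parallel classes. (It is given no topology here.) -/
def Classes : Type := Quotient Par.rel

/-- The parallel class of a line. -/
def classOf (l : Ln) : Par.Classes := Quotient.mk Par.rel l

/-- The action of the automorphism group on the set of parallel classes. -/
instance : MulAction Par.aut Par.Classes where
  smul g := Quotient.map (fun l : Ln => g • l) (fun l m h => (g.2 l m).2 h)
  one_smul c := by
    induction c using Quotient.inductionOn with
    | h l => exact congrArg Par.classOf (one_smul _ l)
  mul_smul g h c := by
    induction c using Quotient.inductionOn with
    | h l => exact congrArg Par.classOf (mul_smul g h l)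

variable {Par}

/-- `Ψ` fixes the point `p`. -/
def FixesPt (Ψ : Subgroup Par.aut) (p : Pt) : Prop := ∀ g : Ψ, g • p = p

/-- `Ψ` fixes the hyperplane `H`, that is, its elements map the point set of `H` onto itself. -/
def FixesHyp (Ψ : Subgroup Par.aut) (H : Hyp) : Prop :=
  ∀ g : Ψ, (fun q : Pt => g • q) '' {q | Inc q H} = {q | Inc q H}

/-- The pencil of all lines through `p`, with the action of a group `Ψ` fixing `p`. -/
def pencil (Ψ : Subgroup Par.aut) (p : Pt) (h : FixesPt Ψ p) : SubMulAction Ψ Ln where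
  carrier := {l | Inc p l}
  smul_mem' g l hl := by
    have h1 : Inc (g • p) (g • l) := (inc_smul_iff g.1.1 p l).2 hl
    rw [h g] at h1
    exact h1

/-- The set of all lines contained in `H`, with the action of a group `Ψ` fixing `H`. -/
def linesIn (Ψ : Subgroup Par.aut) (H : Hyp) (h : FixesHyp Ψ H) : SubMulAction Ψ Ln where
  carrier := {l | Inc l H}
  smul_mem' g l hl := by
    refine (inc_iff_points _ _).2 fun q hq => ?_
    have h1 : Inc (g⁻¹ • q) l := by
      have h2 : Inc (g⁻¹ • q) (g⁻¹ • g • l) := (inc_smul_iff (g⁻¹).1.1 q (g • l)).2 hq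
      rwa [inv_smul_smul] at h2
    have h3 : g⁻¹ • q ∈ {q : Pt | Inc q H} := (inc_iff_points _ _).1 hl _ h1
    have h4 := Set.mem_image_of_mem (fun q : Pt => g • q) h3
    rw [h g] at h4
    simpa using h4

end Parallelism

/-- `f` is a topological equivalence between the actions of `G` on `X` and on `Y`:
an equivariant homeomorphism. -/
def IsTopEquivalence (G : Type*) [Group G] {X Y : Type*} [MulAction G X] [MulAction G Y]
    [TopologicalSpace X] [TopologicalSpace Y] (f : X → Y) : Prop :=
  IsHomeomorph f ∧ ∀ (g : G) (x : X), f (g • x) = g • f x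

end PG3

namespace PG3

open Module

/-! The topology is the quotient topology. It is forced, because a homeomorphism onto the set of
classes determines the topology there, and a single pencil with trivial `Ψ` supplies one.
Equivariance is immediate, since the action on classes is induced from lines.

For a pencil, `l ↦ Par.parallel p l` descends to a continuous inverse. Hence the class space is
Hausdorff, like the space of lines. The lines in a plane `H` form a compact space, so a continuous
bijection onto the classes is enough there. It is injective because two lines of `H` meet.

Surjectivity (`IsTopological.exists_rel_inc_hyp`) is the core. If no parallel of `l` lies in `H`,
move a point `x` around a projective line of `H` that misses `l`. Its parallel to `l` is skew to `l`
and leaves `H` along a vector `y` chosen continuously. With a basis of `l`, `x` and `y` have nonzero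
determinant; yet one circuit replaces `x` by `-x` and restores `y`, against the intermediate value
theorem. -/

theorem eq_coinduced_of_isHomeomorph {X Y : Type*} [TopologicalSpace X] {τ : TopologicalSpace Y}
    {f : X → Y} (hf : IsHomeomorph f) : τ = TopologicalSpace.coinduced f inferInstance :=
  hf.isQuotientMap.isCoinducing.eq_coinduced

/-! ### Grassmannians: Hausdorff and compactness properties -/

theorem Gr.continuous_ofFrame {k : ℕ} : Continuous (Gr.ofFrame (k := k)) :=
  continuous_coinduced_rng

theorem Gr.exists_frame {k : ℕ} (W : Gr k) :
    ∃ v : Fin k → V, Orthonormal ℝ v ∧ (∀ i, v i ∈ W.1) ∧ Submodule.span ℝ (Set.range v) = W.1 := by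
  obtain ⟨W, rfl⟩ := W
  let b := stdOrthonormalBasis ℝ W
  refine ⟨fun i => (b i : V), b.orthonormal.comp_linearIsometry W.subtypeₗᵢ, fun i => (b i).2, ?_⟩
  have h := congrArg (Submodule.map W.subtype) b.toBasis.span_eq
  rw [Submodule.map_span, ← Set.range_comp, Submodule.map_top, Submodule.range_subtype] at h
  simpa [Function.comp_def] using h

theorem Gr.exists_ofFrame_eq {k : ℕ} (W : Gr k) : ∃ v, Gr.ofFrame v = W := by
  obtain ⟨v, hv, -, hs⟩ := W.exists_frame
  exact ⟨⟨v, hv.linearIndependent⟩, Subtype.ext hs⟩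

theorem Gr.isQuotientMap_ofFrame {k : ℕ} : Topology.IsQuotientMap (Gr.ofFrame (k := k)) :=
  ⟨⟨rfl⟩, Gr.exists_ofFrame_eq⟩

theorem gram_pos {u v : V} (h : LinearIndependent ℝ ![u, v]) :
    0 < inner ℝ u u * inner ℝ v v - inner ℝ u v * inner ℝ u v := by
  have hu : u ≠ 0 := h.ne_zero 0
  have huu : 0 < inner ℝ u u := real_inner_self_pos.2 hu
  have hw : (inner ℝ u u : ℝ) • v - (inner ℝ u v : ℝ) • u ≠ 0 := by
    intro h0
    have := (LinearIndependent.pair_iff.1 h) (-inner ℝ u v) (inner ℝ u u) (by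
      rw [← h0, neg_smul]; abel)
    exact huu.ne' this.2
  have := real_inner_self_pos.2 hw
  have e : inner ℝ ((inner ℝ u u : ℝ) • v - (inner ℝ u v : ℝ) • u)
      ((inner ℝ u u : ℝ) • v - (inner ℝ u v : ℝ) • u) =
      inner ℝ u u * (inner ℝ u u * inner ℝ v v - inner ℝ u v * inner ℝ u v) := by
    simp only [inner_sub_left, inner_sub_right, real_inner_smul_left, real_inner_smul_right,
      real_inner_comm u v]
    ring
  rw [e] at this
  exact pos_of_mul_pos_right this huu.le

/-- Cramer's rule for the normal equations; the formula is visibly continuous in the frame `u`, `v`.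
-/
theorem starProjection_span_pair {u v : V} (h : LinearIndependent ℝ ![u, v]) (x : V) :
    (Submodule.span ℝ {u, v}).starProjection x =
      (inner ℝ u u * inner ℝ v v - inner ℝ u v * inner ℝ u v)⁻¹ •
        ((inner ℝ x u * inner ℝ v v - inner ℝ x v * inner ℝ u v : ℝ) • u +
          (inner ℝ x v * inner ℝ u u - inner ℝ x u * inner ℝ u v : ℝ) • v) := by
  have hΔ := (gram_pos h).ne'
  refine Submodule.eq_starProjection_of_mem_of_inner_eq_zero ?_ ?_
  · exact Submodule.smul_mem _ _ (Submodule.mem_span_pair.2 ⟨_, _, rfl⟩)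
  · intro w hw
    obtain ⟨s, t, rfl⟩ := Submodule.mem_span_pair.1 hw
    simp only [inner_sub_left, inner_add_left, inner_add_right, real_inner_smul_left,
      real_inner_smul_right, real_inner_comm u v]
    linear_combination -(s * inner ℝ x u + t * inner ℝ x v) * mul_inv_cancel₀ hΔ

theorem Gr.continuous_starProjection (x : V) : Continuous fun l : Ln => l.1.starProjection x := by
  rw [Gr.isQuotientMap_ofFrame.continuous_iff]
  have hLI : ∀ v : {v : Fin 2 → V // LinearIndependent ℝ v},
      LinearIndependent ℝ ![v.1 0, v.1 1] := by
    intro v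
    convert v.2 using 1
    ext i; fin_cases i <;> rfl
  have : (fun l : Ln => l.1.starProjection x) ∘ Gr.ofFrame =
      fun v : {v : Fin 2 → V // LinearIndependent ℝ v} =>
      (inner ℝ (v.1 0) (v.1 0) * inner ℝ (v.1 1) (v.1 1) -
        inner ℝ (v.1 0) (v.1 1) * inner ℝ (v.1 0) (v.1 1) : ℝ)⁻¹ •
        ((inner ℝ x (v.1 0) * inner ℝ (v.1 1) (v.1 1) -
            inner ℝ x (v.1 1) * inner ℝ (v.1 0) (v.1 1) : ℝ) • v.1 0 +
          (inner ℝ x (v.1 1) * inner ℝ (v.1 0) (v.1 0) -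
            inner ℝ x (v.1 0) * inner ℝ (v.1 0) (v.1 1) : ℝ) • v.1 1) := by
    ext1 v
    rw [← starProjection_span_pair (hLI v)]
    have hr : Set.range v.1 = {v.1 0, v.1 1} := by
      ext y; simp [Fin.exists_fin_two, eq_comm]
    simp only [Function.comp_apply, Gr.ofFrame, hr]
  rw [this]
  have h0 : Continuous fun v : {v : Fin 2 → V // LinearIndependent ℝ v} => v.1 0 :=
    (continuous_apply 0).comp continuous_subtype_val
  have h1 : Continuous fun v : {v : Fin 2 → V // LinearIndependent ℝ v} => v.1 1 :=
    (continuous_apply 1).comp continuous_subtype_val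
  have hx {z : {v : Fin 2 → V // LinearIndependent ℝ v} → V} (hz : Continuous z) :
      Continuous fun v => inner ℝ x (z v) := continuous_const.inner hz
  have h01 := h0.inner (𝕜 := ℝ) h1
  have h00 := h0.inner (𝕜 := ℝ) h0
  have h11 := h1.inner (𝕜 := ℝ) h1
  exact (((h00.mul h11).sub (h01.mul h01)).inv₀ fun v => (gram_pos (hLI v)).ne').smul
    (((((hx h0).mul h11).sub ((hx h1).mul h01)).smul h0).add
      ((((hx h1).mul h00).sub ((hx h0).mul h01)).smul h1))

instance : T2Space Ln := by
  refine ⟨fun l m hlm => ?_⟩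
  have hnle : ¬ l.1 ≤ m.1 := fun hle =>
    hlm (Subtype.ext (Submodule.eq_of_le_of_finrank_eq hle (l.2.trans m.2.symm)))
  obtain ⟨x, hxl, hxm⟩ := SetLike.not_le_iff_exists.1 hnle
  -- The projection of `x` fixes `x` exactly for those lines that contain it.
  refine separated_by_continuous (Gr.continuous_starProjection x) fun h => hxm ?_
  rw [Submodule.starProjection_eq_self_iff.2 hxl] at h
  exact Submodule.starProjection_eq_self_iff.1 h.symm

/-- A continuous image of the compact set of orthonormal pairs in `H`. -/
theorem isCompact_linesIn (H : Hyp) : IsCompact {l : Ln | Inc l H} := by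
  let S : Set (Fin 2 → V) := {v | Orthonormal ℝ v ∧ ∀ i, v i ∈ H.1}
  have hS : IsCompact S := by
    refine Metric.isCompact_of_isClosed_isBounded ?_ ?_
    · have : S = (⋂ i, ⋂ j, {v | inner ℝ (v i) (v j) = if i = j then (1 : ℝ) else 0}) ∩
          ⋂ i, (fun v : Fin 2 → V => v i) ⁻¹' (H.1 : Set V) := by
        ext v
        simp [S, orthonormal_iff_ite]
      rw [this]
      refine IsClosed.inter (isClosed_iInter fun i => isClosed_iInter fun j =>
        isClosed_eq (by fun_prop) continuous_const) (isClosed_iInter fun i => ?_)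
      exact (Submodule.closed_of_finiteDimensional H.1).preimage (continuous_apply i)
    · refine (Metric.isBounded_closedBall (x := (0 : Fin 2 → V)) (r := 1)).subset fun v hv => ?_
      rw [mem_closedBall_zero_iff, pi_norm_le_iff_of_nonneg zero_le_one]
      exact fun i => (hv.1.1 i).le
  have : CompactSpace S := isCompact_iff_compactSpace.1 hS
  let F : S → Ln := fun v => Gr.ofFrame ⟨v.1, v.2.1.linearIndependent⟩
  have hF : Continuous F := Gr.continuous_ofFrame.comp (by fun_prop)
  convert isCompact_range hF
  ext l
  constructor
  · intro hl
    obtain ⟨v, hv, hm, hs⟩ := l.exists_frame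
    exact ⟨⟨v, hv, fun i => hl (hm i)⟩, Subtype.ext hs⟩
  · rintro ⟨v, rfl⟩
    exact Submodule.span_le.2 (Set.range_subset_iff.2 v.2.2)

/-! ### Linear algebra of points, lines and planes -/

/-- The point spanned by a nonzero vector. -/
def ptOf (x : V) (hx : x ≠ 0) : Pt := ⟨Submodule.span ℝ {x}, finrank_span_singleton hx⟩

theorem inc_ptOf {x : V} (hx : x ≠ 0) {k : ℕ} (A : Gr k) : Inc (ptOf x hx) A ↔ x ∈ A.1 :=
  Submodule.span_singleton_le_iff_mem x A.1

theorem continuous_ptOf {X : Type*} [TopologicalSpace X] {f : X → V} (hf : Continuous f)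
    (h0 : ∀ t, f t ≠ 0) : Continuous fun t => ptOf (f t) (h0 t) := by
  have h : (fun t => ptOf (f t) (h0 t)) = fun t => Gr.ofFrame (k := 1)
      ⟨fun _ => f t, LinearIndependent.of_subsingleton (0 : Fin 1) (h0 t)⟩ := by
    ext1 t
    exact Subtype.ext (by simp [ptOf, Gr.ofFrame])
  rw [h]
  exact Gr.continuous_ofFrame.comp (by fun_prop)

theorem exists_pair_of_two_le_finrank {K : Submodule ℝ V} (hK : 2 ≤ finrank ℝ K) :
    ∃ a b : V, a ∈ K ∧ b ∈ K ∧ LinearIndependent ℝ ![a, b] := by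
  let f : Fin 2 → K := finBasis ℝ K ∘ Fin.castLE hK
  have hf : LinearIndependent ℝ f :=
    (finBasis ℝ K).linearIndependent.comp _ (Fin.castLE_injective hK)
  refine ⟨f 0, f 1, (f 0).2, (f 1).2, ?_⟩
  have h : ![(f 0 : V), (f 1 : V)] = K.subtype ∘ f := by
    funext i; fin_cases i <;> rfl
  rw [h]
  exact hf.map' K.subtype (Submodule.ker_subtype K)

theorem exists_common_point {H : Hyp} {l m : Ln} (hl : Inc l H) (hm : Inc m H) :
    ∃ p : Pt, Inc p l ∧ Inc p m := by
  have h1 := Submodule.finrank_sup_add_finrank_inf_eq l.1 m.1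
  have h2 := Submodule.finrank_mono (sup_le hl hm : l.1 ⊔ m.1 ≤ H.1)
  have hl2 : finrank ℝ l.1 = 2 := l.2
  have hm2 : finrank ℝ m.1 = 2 := m.2
  have hH : finrank ℝ H.1 = 3 := H.2
  have hne : l.1 ⊓ m.1 ≠ ⊥ := by
    intro h
    rw [h, finrank_bot] at h1
    omega
  obtain ⟨x, hx, h0⟩ := Submodule.exists_mem_ne_zero_of_ne_bot hne
  exact ⟨ptOf x h0, (inc_ptOf h0 l).2 hx.1, (inc_ptOf h0 m).2 hx.2⟩

/-- Gives a projective line of `H` missing `M`: a complement `Q` of `M ⊓ H` has dimension at least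
3, so it meets `H` in dimension at least 2. -/
theorem exists_pair_disjoint {H : Hyp} {M : Ln} (hM : ¬ Inc M H) :
    ∃ a b : V, a ∈ H.1 ∧ b ∈ H.1 ∧ ∀ s t : ℝ, s • a + t • b ∈ M.1 → s = 0 ∧ t = 0 := by
  have hlt : M.1 ⊓ H.1 < M.1 := inf_lt_left.2 hM
  have h1 := Submodule.finrank_lt_finrank_of_lt hlt
  have hM2 : finrank ℝ M.1 = 2 := M.2
  have hH : finrank ℝ H.1 = 3 := H.2
  obtain ⟨Q, hQ⟩ := exists_isCompl (M.1 ⊓ H.1)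
  have h2 := Submodule.finrank_add_eq_of_isCompl hQ
  have h3 := Submodule.finrank_sup_add_finrank_inf_eq Q H.1
  have h4 := Submodule.finrank_le (Q ⊔ H.1)
  have h5 : finrank ℝ V = 4 := by simp
  obtain ⟨a, b, ha, hb, hab⟩ := exists_pair_of_two_le_finrank (K := Q ⊓ H.1) (by omega)
  refine ⟨a, b, ha.2, hb.2, fun s t h => LinearIndependent.pair_iff.1 hab s t ?_⟩
  have hm := (Q ⊓ H.1).add_mem ((Q ⊓ H.1).smul_mem s ha) ((Q ⊓ H.1).smul_mem t hb)
  exact Submodule.disjoint_def.1 hQ.disjoint _ ⟨h, hm.2⟩ hm.1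

/-- Take `e` normal to `H`. If its projection to `W` lies in `H`, it is orthogonal to `e`, hence
zero, so `W ≤ H`. -/
theorem Gr.exists_normal (H : Hyp) : ∃ e : V, ∀ W : Submodule ℝ V, ¬ W ≤ H.1 →
    W.starProjection e ∉ H.1 := by
  have h1 := Submodule.finrank_add_finrank_orthogonal H.1
  have hH : finrank ℝ H.1 = 3 := H.2
  have h5 : finrank ℝ V = 4 := by simp
  obtain ⟨e, he⟩ := finrank_eq_one_iff'.1 (show finrank ℝ H.1ᗮ = 1 by omega)
  have hHe : ∀ x : V, inner ℝ (e : V) x = 0 → x ∈ H.1 := by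
    intro x hx
    rw [← Submodule.orthogonal_orthogonal H.1, Submodule.mem_orthogonal]
    intro u hu
    obtain ⟨c, hc⟩ := he.2 ⟨u, hu⟩
    have : u = c • (e : V) := (congrArg Subtype.val hc).symm
    rw [this, real_inner_smul_left, hx, mul_zero]
  refine ⟨e, fun W hW hmem => hW fun w hw => hHe w ?_⟩
  have h0 : inner ℝ (W.starProjection (e : V)) (e : V) = 0 :=
    Submodule.inner_right_of_mem_orthogonal hmem e.2
  have h2 : W.starProjection (e : V) = 0 := by
    rw [← inner_self_eq_zero (𝕜 := ℝ)]
    have := Submodule.starProjection_inner_eq_zero (K := W) (e : V) _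
      (Submodule.starProjection_apply_mem W (e : V))
    rw [inner_sub_left, real_inner_comm, h0] at this
    linarith
  have h3 := Submodule.starProjection_inner_eq_zero (K := W) (e : V) w hw
  rwa [h2, sub_zero] at h3

/-- The determinant of four vectors of `ℝ⁴`. -/
noncomputable def det4 (m n x y : V) : ℝ := Matrix.det (Matrix.of fun i j => (![m, n, x, y] i) j)

theorem det4_ne_zero {m n x y : V} (h : LinearIndependent ℝ ![m, n, x, y]) :
    det4 m n x y ≠ 0 := by
  rw [det4, ← isUnit_iff_ne_zero, ← Matrix.isUnit_iff_isUnit_det,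
    ← Matrix.linearIndependent_rows_iff_isUnit]
  exact h.map' (WithLp.linearEquiv 2 ℝ (Fin 4 → ℝ)).toLinearMap (LinearEquiv.ker _)

theorem det4_neg (m n x y : V) : det4 m n (-x) y = -det4 m n x y := by
  simp [det4, Matrix.det_succ_row_zero, Fin.sum_univ_succ, Fin.succAbove]
  ring

theorem continuous_det4 (m n : V) {X : Type*} [TopologicalSpace X] {x y : X → V}
    (hx : Continuous x) (hy : Continuous y) : Continuous fun t => det4 m n (x t) (y t) := by
  refine Continuous.matrix_det (continuous_matrix fun i j => ?_)
  fin_cases i <;> simp <;> fun_prop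

/-! ### Parallel classes and their topology -/

namespace Parallelism

variable (Par : Parallelism)

theorem inc_parallel (p : Pt) (l : Ln) : Inc p (Par.parallel p l) :=
  (Par.existsUnique_parallel p l).choose_spec.1.1

theorem rel_parallel (p : Pt) (l : Ln) : Par.rel (Par.parallel p l) l :=
  (Par.existsUnique_parallel p l).choose_spec.1.2

theorem eq_parallel {p : Pt} {l m : Ln} (hp : Inc p m) (h : Par.rel m l) :
    m = Par.parallel p l :=
  (Par.existsUnique_parallel p l).choose_spec.2 m ⟨hp, h⟩

theorem eq_of_rel_of_inc {p : Pt} {l m : Ln} (h : Par.rel l m) (hl : Inc p l) (hm : Inc p m) :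
    l = m :=
  (Par.eq_parallel hl h).trans (Par.eq_parallel hm (Par.rel.refl' m)).symm

variable {Par}

theorem IsTopological.exists_rel_inc_hyp (hPar : Par.IsTopological) (l : Ln) (H : Hyp) :
    ∃ m : Ln, Par.rel m l ∧ Inc m H := by
  by_contra! hno
  obtain ⟨a, b, ha, hb, hab⟩ := exists_pair_disjoint (hno l (Par.rel.refl' l))
  obtain ⟨e, he⟩ := Gr.exists_normal H
  obtain ⟨v, hv, hvl, -⟩ := l.exists_frame
  let x : ℝ → V := fun t => Real.cos t • a + Real.sin t • b
  have hxl : ∀ t, x t ∉ l.1 := by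
    intro t h
    obtain ⟨hc, hs⟩ := hab _ _ h
    have := Real.cos_sq_add_sin_sq t
    simp [hc, hs] at this
  have hx0 : ∀ t, x t ≠ 0 := fun t h => hxl t (h ▸ l.1.zero_mem)
  have hxH : ∀ t, x t ∈ H.1 := fun t => H.1.add_mem (H.1.smul_mem _ ha) (H.1.smul_mem _ hb)
  have hxc : Continuous x := by fun_prop
  let L : ℝ → Ln := fun t => Par.parallel (ptOf (x t) (hx0 t)) l
  have hLc : Continuous L :=
    Continuous.comp hPar ((continuous_ptOf hxc hx0).prodMk continuous_const)
  -- `y t` depends only on the line `L t`, so it has no sign ambiguity.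
  let y : ℝ → V := fun t => (L t).1.starProjection e
  have hyc : Continuous y := (Gr.continuous_starProjection e).comp hLc
  have hxL : ∀ t, x t ∈ (L t).1 := fun t => (inc_ptOf (hx0 t) _).1 (Par.inc_parallel _ l)
  have hyL : ∀ t, y t ∈ (L t).1 := fun t => Submodule.starProjection_apply_mem _ _
  have hyH : ∀ t, y t ∉ H.1 := fun t => he _ (hno _ (Par.rel_parallel _ l))
  have hdisj : ∀ t, Disjoint l.1 (L t).1 := by
    intro t
    rw [Submodule.disjoint_def]
    intro z hz hz'
    by_contra h0
    have := Par.eq_of_rel_of_inc (Par.rel_parallel (ptOf (x t) (hx0 t)) l)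
      ((inc_ptOf h0 _).2 hz') ((inc_ptOf h0 l).2 hz)
    apply hxl t
    rw [← this]
    exact hxL t
  let D : ℝ → ℝ := fun t => det4 (v 0) (v 1) (x t) (y t)
  have hDc : Continuous D := continuous_det4 _ _ hxc hyc
  have hD0 : ∀ t, D t ≠ 0 := by
    intro t
    refine det4_ne_zero (Fintype.linearIndependent_iff.2 fun c hc => ?_)
    simp only [Fin.sum_univ_four, Matrix.cons_val] at hc
    have hm1 : c 0 • v 0 + c 1 • v 1 ∈ l.1 :=
      l.1.add_mem (l.1.smul_mem _ (hvl 0)) (l.1.smul_mem _ (hvl 1))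
    have hm2 : c 2 • x t + c 3 • y t ∈ (L t).1 :=
      (L t).1.add_mem ((L t).1.smul_mem _ (hxL t)) ((L t).1.smul_mem _ (hyL t))
    have hs : c 0 • v 0 + c 1 • v 1 = -(c 2 • x t + c 3 • y t) := by
      rw [eq_neg_iff_add_eq_zero, ← hc]; abel
    have h1 : c 0 • v 0 + c 1 • v 1 = 0 :=
      Submodule.disjoint_def.1 (hdisj t) _ hm1 (hs ▸ (L t).1.neg_mem hm2)
    have h2 : c 2 • x t + c 3 • y t = 0 := by
      rw [← neg_eq_zero, ← hs, h1]
    have h3 : c 3 = 0 := by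
      by_contra h3
      have hy : c 3 • y t ∈ H.1 := by
        rw [eq_neg_of_add_eq_zero_right h2]
        exact H.1.neg_mem (H.1.smul_mem _ (hxH t))
      exact hyH t ((H.1.smul_mem_iff h3).1 hy)
    have h4 : c 2 = 0 := by
      rw [h3, zero_smul, add_zero] at h2
      exact (smul_eq_zero.1 h2).resolve_right (hx0 t)
    have h5 := Fintype.linearIndependent_iff.1 hv.linearIndependent ![c 0, c 1]
      (by simpa [Fin.sum_univ_two] using h1)
    intro i
    fin_cases i
    · exact h5 0
    · exact h5 1
    · exact h4
    · exact h3
  -- A half-turn returns to the same projective point with the opposite vector.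
  have hxπ : x Real.pi = -x 0 := by simp [x]
  have hLπ : L Real.pi = L 0 := by
    have : ptOf (x Real.pi) (hx0 _) = ptOf (x 0) (hx0 _) := by
      refine Subtype.ext ?_
      simp only [ptOf, hxπ]
      rw [← Set.neg_singleton, Submodule.span_neg]
    simp only [L, this]
  have hyπ : y Real.pi = y 0 := by simp only [y, hLπ]
  have hDπ : D Real.pi = -D 0 := by simp only [D, hxπ, hyπ, det4_neg]
  have hz : (0 : ℝ) ∈ Set.range D := by
    rcases le_total 0 (D 0) with h | h
    · exact mem_range_of_exists_le_of_exists_ge hDc ⟨Real.pi, by linarith⟩ ⟨0, h⟩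
    · exact mem_range_of_exists_le_of_exists_ge hDc ⟨0, h⟩ ⟨Real.pi, by linarith⟩
  obtain ⟨t, ht⟩ := hz
  exact hD0 t ht

variable (Par) in
/-- The quotient topology on the set of parallel classes. -/
abbrev classTopology : TopologicalSpace Par.Classes :=
  TopologicalSpace.coinduced Par.classOf inferInstance

theorem continuous_classOf : @Continuous _ _ _ Par.classTopology Par.classOf :=
  continuous_coinduced_rng

/-- The pencil of lines through a point is homeomorphic to the space of parallel classes. -/
theorem IsTopological.isHomeomorph_classOf_pencil (hPar : Par.IsTopological) (p : Pt) :
    letI := Par.classTopology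
    IsHomeomorph fun l : {l : Ln | Inc p l} => Par.classOf l := by
  let := Par.classTopology
  let g : Par.Classes → {l : Ln | Inc p l} := fun c => Quotient.liftOn c
    (fun l => ⟨Par.parallel p l, Par.inc_parallel p l⟩) fun l m h => Subtype.ext <|
      Par.eq_parallel (Par.inc_parallel p l) (Par.rel.trans' (Par.rel_parallel p l) h)
  have hg : Continuous g := by
    refine continuous_coinduced_dom.2 (Continuous.subtype_mk ?_ _)
    exact Continuous.comp hPar (continuous_const.prodMk continuous_id)
  have hleft : Function.LeftInverse g fun l : {l : Ln | Inc p l} => Par.classOf l := fun l =>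
    Subtype.ext (Par.eq_parallel l.2 (Par.rel.refl' _)).symm
  have hright : Function.RightInverse g fun l : {l : Ln | Inc p l} => Par.classOf l := by
    intro c
    induction c using Quotient.inductionOn with
    | h l => exact Quotient.sound (Par.rel_parallel p l)
  exact (Homeomorph.mk ⟨_, g, hleft, hright⟩
    (continuous_classOf.comp continuous_subtype_val) hg).isHomeomorph

theorem IsTopological.t2Space_classes (hPar : Par.IsTopological) (p : Pt) :
    @T2Space Par.Classes Par.classTopology := by
  let := Par.classTopology
  exact (hPar.isHomeomorph_classOf_pencil p).homeomorph.t2Space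

/-- The space of lines in a hyperplane is homeomorphic to the space of parallel classes. -/
theorem IsTopological.isHomeomorph_classOf_linesIn (hPar : Par.IsTopological) (p : Pt) (H : Hyp) :
    letI := Par.classTopology
    IsHomeomorph fun l : {l : Ln | Inc l H} => Par.classOf l := by
  let := Par.classTopology
  have := hPar.t2Space_classes p
  have : CompactSpace {l : Ln | Inc l H} := isCompact_iff_compactSpace.1 (isCompact_linesIn H)
  refine isHomeomorph_iff_continuous_bijective.2
    ⟨continuous_classOf.comp continuous_subtype_val, fun l m h => ?_, fun c => ?_⟩
  · obtain ⟨q, hl, hm⟩ := exists_common_point l.2 m.2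
    exact Subtype.ext (Par.eq_of_rel_of_inc (Quotient.exact h) hl hm)
  · induction c using Quotient.inductionOn with
    | h l =>
      obtain ⟨m, hm, hH⟩ := hPar.exists_rel_inc_hyp l H
      exact ⟨⟨m, hH⟩, Quotient.sound hm⟩

end Parallelism

instance : Nonempty Pt :=
  ⟨ptOf (EuclideanSpace.single 0 1) fun h => one_ne_zero (α := ℝ) (by simpa using congr($h 0))⟩

end PG3

theorem mainTheorem2 (Par : PG3.Parallelism) (hPar : Par.IsTopological) :
    ∃! _τ : TopologicalSpace Par.Classes, ∀ Ψ : Subgroup Par.aut,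
      (∀ (p : PG3.Pt) (hp : PG3.Parallelism.FixesPt Ψ p),
        PG3.IsTopEquivalence Ψ
          (fun l : PG3.Parallelism.pencil Ψ p hp => Par.classOf (l : PG3.Ln))) ∧
      (∀ (H : PG3.Hyp) (hH : PG3.Parallelism.FixesHyp Ψ H),
        PG3.IsTopEquivalence Ψ
          (fun l : PG3.Parallelism.linesIn Ψ H hH => Par.classOf (l : PG3.Ln))) := by
  obtain ⟨p⟩ := (inferInstance : Nonempty PG3.Pt)
  refine ⟨Par.classTopology, fun Ψ => ⟨fun q hq => ⟨?_, fun g l => rfl⟩,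
    fun H hH => ⟨?_, fun g l => rfl⟩⟩, fun τ hτ => ?_⟩
  · exact hPar.isHomeomorph_classOf_pencil q
  · exact hPar.isHomeomorph_classOf_linesIn p H
  -- The trivial group fixes every point, so its pencil at `p` determines `τ`.
  · have hp : PG3.Parallelism.FixesPt (⊥ : Subgroup Par.aut) p := by
      rintro ⟨g, hg⟩
      obtain rfl := Subgroup.mem_bot.1 hg
      rfl
    have h1 := ((hτ ⊥).1 p hp).1
    have h2 := hPar.isHomeomorph_classOf_pencil p
    exact (PG3.eq_coinduced_of_isHomeomorph h1).trans
      (PG3.eq_coinduced_of_isHomeomorph h2).symm
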